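/- Let $G$ be a Polish group with operation $\bullet$ and identity $e$ (not necessarily abelian), with its Borel $\sigma$-algebra, and let $\mathcal Y=\{g\bullet H : g\in G,\ H\lhd G \text{ a finite normal subgroup}\}$ be the collection of its finite cosets. Let $X_1,X_2,\dots$ be $G$-valued and $Y_1,Y_2,\dots$ be $\mathcal Y$-valued random variables on a common probability space, such that the pairs $(X_i,Y_i)$, $i\ge 1$, are mutually independent (not necessarily identically distributed) and such that each $(X_i,Y_i)$ follows an erasure distribution: for every Borel set $B\subset G$, $$P_{X_i|Y_i}(B)=\frac{|B\cap Y_i|}{|Y_i|}\quad\text{a.s.},$$ where $P_{X|Y}$ denotes the regular conditional distribution of $X$ relative to $Y$. For $n\ge 1$ and $i\ge 1$ put $m=\lfloor (i-1)/2^{n-1}\rfloor$ and $j=i+m2^{n-1}$. Define recursively $U_0^{(i)}=X_i$, $Y_0^{(i)}=Y_i$, and for $n\ge1$ $$U_n^{(2i-1)}=U_{n-1}^{(j)}\bullet U_{n-1}^{(j+2^{n-1})},\qquad U_n^{(2i)}=U_{n-1}^{(j+2^{n-1})},$$ $$Y_n^{(2i-1)}=Y_{n-1}^{(j)}\bullet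 Y_{n-1}^{(j+2^{n-1})},\qquad Y_n^{(2i)}=\phi\bigl(U_n^{(2i-1)},\,Y_{n-1}^{(j)},\,Y_{n-1}^{(j+2^{n-1})}\bigr),$$ where $\phi(g,\,a\bullet H,\,b\bullet K)=(a^{-1}\bullet g\bullet H)\cap(b\bullet K)$, and where $Y_n^{(2i)}=\{e\}$ by convention if this intersection is empty. Then, for all $n\ge0$ and $i\ge1$, the variable $U_n^{(i)}$ is conditionally discrete relative to $(\{U_n^{(k)}\}_{k=1}^{i-1},\{Y_k\}_{k=1}^{\infty})$ (its conditional distribution is a.s. carried by an a.s. countable random Borel set), $\log|Y_n^{(i)}|$ is measurable up to a null set, and $$H\bigl(U_n^{(i)}\,\big|\,\{U_n^{(k)}\}_{k=1}^{i-1},\{Y_k\}_{k=1}^{\infty}\bigr)=\mathbb E\bigl[\log|Y_n^{(i)}|\bigr]$$ as elements of $[0,\infty]$. Here $\log$ is the natural logarithm and $H(X\mid Y)=\mathbb E\bigl[\sum_{x}P_{X|Y}(\{x\})\log\frac1{P_{X|Y}(\{x\})}\bigr]$, with $0\log\frac10=0$. -/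

import Mathlib

open MeasureTheory ProbabilityTheory
open scoped Pointwise ENNReal

noncomputable section

/-- The collection of the finite cosets `g • H` of a group `G`, where `H` ranges over the finite
normal subgroups of `G` (topology plays no role here, a finite coset is a plain set). -/
structure FinCoset (G : Type*) [Group G] where
  carrier : Set G
  isCoset : ∃ (g : G) (H : Subgroup G), H.Normal ∧ (H : Set G).Finite ∧ carrier = g • (H : Set G)

namespace FinCoset

variable {G : Type*} [Group G]

/-- The cardinality `|C|` of a finite coset. -/
def card (C : FinCoset G) : ℕ := C.carrier.ncard

/-- The coset `{e}` of the trivial subgroup. -/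
def trivial : FinCoset G where
  carrier := {1}
  isCoset := ⟨1, ⊥, inferInstance, by simp, by simp⟩

theorem isCoset_mul (C D : FinCoset G) :
    ∃ (g : G) (H : Subgroup G), H.Normal ∧ (H : Set G).Finite ∧
      C.carrier * D.carrier = g • (H : Set G) := by
  obtain ⟨a, H, hH, fH, hC⟩ := C.isCoset
  obtain ⟨b, K, hK, fK, hD⟩ := D.isCoset
  have hHK : ((H ⊔ K : Subgroup G) : Set G) = (H : Set G) * (K : Set G) :=
    Subgroup.mul_normal H K
  refine ⟨a * b, H ⊔ K, inferInstance, ?_, ?_⟩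
  · rw [hHK]
    exact fH.mul fK
  · rw [hC, hD, hHK]
    ext x
    simp only [Set.mem_mul, Set.mem_smul_set, smul_eq_mul, SetLike.mem_coe]
    constructor
    · rintro ⟨_, ⟨h, hh, rfl⟩, _, ⟨k, hk, rfl⟩, rfl⟩
      refine ⟨(b⁻¹ * h * b) * k, ⟨b⁻¹ * h * b, ?_, k, hk, rfl⟩, by group⟩
      simpa using hH.conj_mem h hh b⁻¹
    · rintro ⟨_, ⟨h, hh, k, hk, rfl⟩, rfl⟩
      exact ⟨a * (b * h * b⁻¹), ⟨b * h * b⁻¹, hH.conj_mem h hh b, rfl⟩, b * k, ⟨k, hk, rfl⟩,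
        by group⟩

/-- The product `C • D = {c • d | c ∈ C, d ∈ D}` of two finite cosets. -/
def mul (C D : FinCoset G) : FinCoset G where
  carrier := C.carrier * D.carrier
  isCoset := isCoset_mul C D

/-- The map `φ (g, a • H, b • K) = (a⁻¹ • g • H) ∩ (b • K)`, a finite coset or the empty set.
It is written without representatives; `phi_eq` gives the formula above. -/
def phi (g : G) (C D : FinCoset G) : Set G := (C.carrier⁻¹ * {g}) ∩ D.carrier

theorem phi_eq (g a b : G) (H K : Subgroup G) (hH : H.Normal) (C D : FinCoset G)
    (hC : C.carrier = a • (H : Set G)) (hD : D.carrier = b • (K : Set G)) :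
    phi g C D = ((a⁻¹ * g) • (H : Set G)) ∩ (b • (K : Set G)) := by
  rw [phi, hC, hD]
  congr 1
  ext x
  have key : (∃ y, y⁻¹ ∈ a • (H : Set G) ∧ y * g = x) ↔ x ∈ (a⁻¹ * g) • (H : Set G) := by
    simp only [Set.mem_smul_set_iff_inv_smul_mem, smul_eq_mul, SetLike.mem_coe, mul_inv_rev,
      inv_inv]
    constructor
    · rintro ⟨y, hy, hx⟩
      have h1 := hH.conj_mem _ (hH.conj_mem _ (H.inv_mem hy) a) g⁻¹
      rw [← hx]
      convert h1 using 1
      group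
    · intro hx
      refine ⟨x * g⁻¹, ?_, by group⟩
      have h1 := H.inv_mem (hH.conj_mem _ (hH.conj_mem _ hx g) a⁻¹)
      convert h1 using 1
      group
  rw [← key]
  constructor
  · rintro ⟨y, hy, z, hz, hx⟩
    rw [Set.mem_singleton_iff] at hz
    subst hz
    exact ⟨y, hy, hx⟩
  · rintro ⟨y, hy, hx⟩
    exact ⟨y, hy, g, rfl, hx⟩

theorem isCoset_phi (g : G) (C D : FinCoset G) (h : (phi g C D).Nonempty) :
    ∃ (c : G) (H : Subgroup G), H.Normal ∧ (H : Set G).Finite ∧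
      phi g C D = c • (H : Set G) := by
  obtain ⟨a, H, hH, fH, hC⟩ := C.isCoset
  obtain ⟨b, K, hK, fK, hD⟩ := D.isCoset
  rw [phi_eq g a b H K hH C D hC hD] at h ⊢
  obtain ⟨c, hc1, hc2⟩ := h
  refine ⟨c, H ⊓ K, inferInstance, fH.subset (fun x hx => hx.1), ?_⟩
  have e1 : (a⁻¹ * g) • (H : Set G) = c • (H : Set G) := by
    rw [Set.mem_smul_set_iff_inv_smul_mem] at hc1
    exact (leftCoset_eq_iff H).2 hc1
  have e2 : b • (K : Set G) = c • (K : Set G) := by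
    rw [Set.mem_smul_set_iff_inv_smul_mem] at hc2
    exact (leftCoset_eq_iff K).2 hc2
  rw [e1, e2, Subgroup.coe_inf, Set.smul_set_inter]

open Classical in
/-- `φ (g, C, D)` as a finite coset, with the value `{e}` where it is empty. -/
def plus (g : G) (C D : FinCoset G) : FinCoset G :=
  if h : (phi g C D).Nonempty then ⟨phi g C D, isCoset_phi g C D h⟩ else trivial

end FinCoset

section Conditional

variable {Ω : Type*} [MeasurableSpace Ω] {𝓧 : Type*} [MeasurableSpace 𝓧] [StandardBorelSpace 𝓧]
  [Nonempty 𝓧] {𝓨 : Type*} [MeasurableSpace 𝓨]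

/-- `X` is conditionally discrete relative to `Y`: there is a random Borel set `D` (one with a
measurable graph) that is a.s. countable and a.s. satisfies `P_{X|Y}(D) = 1`. -/
def CondDiscrete (X : Ω → 𝓧) (Y : Ω → 𝓨) (μ : Measure Ω) [IsFiniteMeasure μ] : Prop :=
  ∃ D : Ω → Set 𝓧, MeasurableSet {p : Ω × 𝓧 | p.2 ∈ D p.1} ∧
    (∀ᵐ ω ∂μ, (D ω).Countable) ∧ ∀ᵐ ω ∂μ, condDistrib X Y μ (Y ω) (D ω) = 1

/-- The conditional Shannon entropy (in nats)
`H(X | Y) = E[∑_x P_{X|Y}(x) log (1 / P_{X|Y}(x))] ∈ [0, ∞]`,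
the notion of interest when `X` is conditionally discrete relative to `Y`.
Here `Real.negMulLog p = - p * log p`. -/
def condEntropy (X : Ω → 𝓧) (Y : Ω → 𝓨) (μ : Measure Ω) [IsFiniteMeasure μ] : ℝ≥0∞ :=
  ∫⁻ ω, ∑' x : 𝓧, ENNReal.ofReal (Real.negMulLog (condDistrib X Y μ (Y ω) {x}).toReal) ∂μ

end Conditional

section Polar

variable {Ω : Type*} {G : Type*} [Group G]

/-- The pair `(X, Y)` follows an erasure distribution:
`P_{X|Y}(B) = |B ∩ Y| / |Y|` a.s., for every Borel set `B`. -/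
def IsErasure [MeasurableSpace Ω] [MeasurableSpace G] [StandardBorelSpace G]
    [MeasurableSpace (FinCoset G)] (X : Ω → G) (Y : Ω → FinCoset G)
    (μ : Measure Ω) [IsFiniteMeasure μ] : Prop :=
  ∀ B : Set G, MeasurableSet B → ∀ᵐ ω ∂μ,
    condDistrib X Y μ (Y ω) B = ((B ∩ (Y ω).carrier).ncard : ℝ≥0∞) / ((Y ω).card : ℝ≥0∞)

/-- All indices start at `0`. The outputs with indices `2 * k` and `2 * k + 1` after step `n + 1`
are obtained from the two outputs with indices `leftIdx n k` and `leftIdx n k + 2 ^ n` after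
step `n`; with `k = m * 2 ^ n + r` and `r < 2 ^ n`, one has `leftIdx n k = m * 2 ^ (n + 1) + r`. -/
def leftIdx (n k : ℕ) : ℕ := k + (k / 2 ^ n) * 2 ^ n

/-- The recursive polar transform of the sequence `X 0, X 1, …`, with
`U (n + 1) (2 * k) = U n j • U n (j + 2 ^ n)` and `U (n + 1) (2 * k + 1) = U n (j + 2 ^ n)`,
where `j = leftIdx n k`. It acts separately on the blocks `m * 2 ^ n, …, (m + 1) * 2 ^ n - 1`. -/
def polarU (X : ℕ → Ω → G) : ℕ → ℕ → Ω → G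
  | 0, i => X i
  | n + 1, i => fun ω =>
    let j := leftIdx n (i / 2)
    if i % 2 = 0 then polarU X n j ω * polarU X n (j + 2 ^ n) ω
    else polarU X n (j + 2 ^ n) ω

/-- The finite cosets attached to the outputs of the polar transform, with
`Y (n + 1) (2 * k) = Y n j • Y n (j + 2 ^ n)` and
`Y (n + 1) (2 * k + 1) = φ (U (n + 1) (2 * k), Y n j, Y n (j + 2 ^ n))`
where `j = leftIdx n k`. -/
def polarY (X : ℕ → Ω → G) (Y : ℕ → Ω → FinCoset G) : ℕ → ℕ → Ω → FinCoset G
  | 0, i => Y i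
  | n + 1, i => fun ω =>
    let j := leftIdx n (i / 2)
    if i % 2 = 0 then (polarY X Y n j ω).mul (polarY X Y n (j + 2 ^ n) ω)
    else FinCoset.plus (polarU X (n + 1) (i - 1) ω) (polarY X Y n j ω)
      (polarY X Y n (j + 2 ^ n) ω)

/-- What the `i`-th output after `n` steps is conditioned on: all the previous outputs after `n`
steps and all the side information. -/
def past (X : ℕ → Ω → G) (Y : ℕ → Ω → FinCoset G) (n i : ℕ) (ω : Ω) :
    (Fin i → G) × (ℕ → FinCoset G) :=
  (fun j => polarU X n j ω, fun j => Y j ω)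

end Polar

end

/-!
Conditionally on the whole sequence `Y`, the inputs are independent and uniform on their cosets, so
the inputs of finitely many blocks form a uniform random point of a finite box of sequences. Fix
such inputs `x` and write the coset of `x j` as `x j • H j`. The subgroups `H j` being normal, the
cosets `polarY` are again the cosets of the outputs, `polarU • polarSubgroup`, where
`polarSubgroup` is obtained from `H` by joins `⊔` and meets `⊓` and does not depend on `x`
(`polarY_carrier`).

Among the points of the box with prescribed previous outputs, the next output lies in its coset
(`inv_polarMap_mul_mem`) and takes every value there (`exists_polarMap_eq_mul`): the joins and meets
are exactly what the two halves of a block can produce. As the transform is injective, a downward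
induction shows that the number of points of the box with prescribed first `i` outputs is the product
of the orders of the remaining subgroups (`ncard_prefixFiber`). In particular it is the same for all
the values of the next output, so this output is uniform on its coset given the previous outputs and
`Y` (`map_uniformOn_prefixFiber`). The entropy of a uniform law is the logarithm of the number of its
atoms, which gives the entropy formula (`condEntropy_of_condDistrib_uniform`).

On the measure-theoretic side, the conditional law of the inputs given `Y` is a finite product of
kernels (`map_prodMk_eq_compProd_kernelPi`), and since it is discrete, conditioning it on the previous
outputs is elementary (`condDistrib_ae_eq_fiberKernel`). The `σ`-algebra on the cosets is arbitrary:
the set of pairs `(x, C)` with `x ∈ C` need not be measurable, and everything measurable is expressed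
through the conditional distributions instead.
-/

/-! ### The transform of a deterministic sequence -/

section Deterministic

variable {G : Type*} [Group G]

/-- The `i`-th output after `n` steps of the polar transform, as a function of the whole input
sequence; this is `polarU` on the canonical space `ℕ → G`. -/
def polarMap (n i : ℕ) (x : ℕ → G) : G := polarU (fun j (y : ℕ → G) => y j) n i x

theorem polarU_eq_polarMap {Ω : Type*} (X : ℕ → Ω → G) (n i : ℕ) (ω : Ω) :
    polarU X n i ω = polarMap n i (fun j => X j ω) := by
  induction n generalizing i with
  | zero => rfl
  | succ n ih =>
    simp only [polarMap, polarU] at ih ⊢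
    split_ifs <;> simp only [ih]

theorem leftIdx_block {n r : ℕ} (m : ℕ) (hr : r < 2 ^ n) :
    leftIdx n (m * 2 ^ n + r) = 2 * m * 2 ^ n + r := by
  have h : (m * 2 ^ n + r) / 2 ^ n = m := by
    rw [mul_comm, Nat.mul_add_div (by positivity), Nat.div_eq_of_lt hr, add_zero]
  rw [leftIdx, h]
  ring

theorem polarMap_zero (i : ℕ) (x : ℕ → G) : polarMap 0 i x = x i := rfl

theorem polarMap_block_even {n r : ℕ} (m : ℕ) (hr : r < 2 ^ n) (x : ℕ → G) :
    polarMap (n + 1) (m * 2 ^ (n + 1) + 2 * r) x =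
      polarMap n (2 * m * 2 ^ n + r) x * polarMap n ((2 * m + 1) * 2 ^ n + r) x := by
  have e : m * 2 ^ (n + 1) + 2 * r = 2 * (m * 2 ^ n + r) := by ring
  have e' : 2 * m * 2 ^ n + r + 2 ^ n = (2 * m + 1) * 2 ^ n + r := by ring
  rw [e]
  simp only [polarMap, polarU]
  rw [Nat.mul_div_cancel_left _ (by norm_num), leftIdx_block m hr, e', if_pos (by omega)]

theorem polarMap_block_odd {n r : ℕ} (m : ℕ) (hr : r < 2 ^ n) (x : ℕ → G) :
    polarMap (n + 1) (m * 2 ^ (n + 1) + (2 * r + 1)) x =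
      polarMap n ((2 * m + 1) * 2 ^ n + r) x := by
  have e : m * 2 ^ (n + 1) + (2 * r + 1) = 2 * (m * 2 ^ n + r) + 1 := by ring
  have e' : 2 * m * 2 ^ n + r + 2 ^ n = (2 * m + 1) * 2 ^ n + r := by ring
  have e'' : (2 * (m * 2 ^ n + r) + 1) / 2 = m * 2 ^ n + r := by omega
  rw [e]
  simp only [polarMap, polarU]
  rw [e'', leftIdx_block m hr, e', if_neg (by omega)]

/-- The finite normal subgroups that shadow the cosets `polarY`: joins at the even outputs and
meets at the odd ones. They depend on the initial subgroups only, not on the inputs. -/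
def polarSubgroup (H : ℕ → Subgroup G) : ℕ → ℕ → Subgroup G
  | 0, i => H i
  | n + 1, i =>
    let j := leftIdx n (i / 2)
    if i % 2 = 0 then polarSubgroup H n j ⊔ polarSubgroup H n (j + 2 ^ n)
    else polarSubgroup H n j ⊓ polarSubgroup H n (j + 2 ^ n)

theorem polarSubgroup_block_even {n r : ℕ} (m : ℕ) (hr : r < 2 ^ n) (H : ℕ → Subgroup G) :
    polarSubgroup H (n + 1) (m * 2 ^ (n + 1) + 2 * r) =
      polarSubgroup H n (2 * m * 2 ^ n + r) ⊔ polarSubgroup H n ((2 * m + 1) * 2 ^ n + r) := by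
  have e : m * 2 ^ (n + 1) + 2 * r = 2 * (m * 2 ^ n + r) := by ring
  have e' : 2 * m * 2 ^ n + r + 2 ^ n = (2 * m + 1) * 2 ^ n + r := by ring
  rw [e]
  simp only [polarSubgroup]
  rw [Nat.mul_div_cancel_left _ (by norm_num), leftIdx_block m hr, e', if_pos (by omega)]

theorem polarSubgroup_block_odd {n r : ℕ} (m : ℕ) (hr : r < 2 ^ n) (H : ℕ → Subgroup G) :
    polarSubgroup H (n + 1) (m * 2 ^ (n + 1) + (2 * r + 1)) =
      polarSubgroup H n (2 * m * 2 ^ n + r) ⊓ polarSubgroup H n ((2 * m + 1) * 2 ^ n + r) := by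
  have e : m * 2 ^ (n + 1) + (2 * r + 1) = 2 * (m * 2 ^ n + r) + 1 := by ring
  have e' : 2 * m * 2 ^ n + r + 2 ^ n = (2 * m + 1) * 2 ^ n + r := by ring
  have e'' : (2 * (m * 2 ^ n + r) + 1) / 2 = m * 2 ^ n + r := by omega
  rw [e]
  simp only [polarSubgroup]
  rw [e'', leftIdx_block m hr, e', if_neg (by omega)]

theorem polarSubgroup_normal {H : ℕ → Subgroup G} (hH : ∀ j, (H j).Normal) (n i : ℕ) :
    (polarSubgroup H n i).Normal := by
  induction n generalizing i with
  | zero => exact hH i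
  | succ n ih =>
    have h1 := ih (leftIdx n (i / 2))
    have h2 := ih (leftIdx n (i / 2) + 2 ^ n)
    simp only [polarSubgroup]
    split_ifs <;> infer_instance

theorem polarSubgroup_finite {H : ℕ → Subgroup G} (hH : ∀ j, (H j).Normal)
    (fH : ∀ j, (H j : Set G).Finite) (n i : ℕ) : (polarSubgroup H n i : Set G).Finite := by
  induction n generalizing i with
  | zero => exact fH i
  | succ n ih =>
    have h1 := ih (leftIdx n (i / 2))
    have h2 := ih (leftIdx n (i / 2) + 2 ^ n)
    have := polarSubgroup_normal hH n (leftIdx n (i / 2) + 2 ^ n)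
    simp only [polarSubgroup]
    split_ifs
    · rw [Subgroup.mul_normal]
      exact h1.mul h2
    · exact h1.subset fun x hx => hx.1

/-- If every `Y j` is the coset of `X j`, then every `polarY` is the coset of `polarU`. In
particular `φ` never has the empty value here. -/
theorem polarY_carrier {Ω : Type*} {X : ℕ → Ω → G} {Y : ℕ → Ω → FinCoset G} {ω : Ω}
    {H : ℕ → Subgroup G} (hH : ∀ j, (H j).Normal)
    (hY : ∀ j, (Y j ω).carrier = X j ω • (H j : Set G)) (n i : ℕ) :
    (polarY X Y n i ω).carrier = polarU X n i ω • (polarSubgroup H n i : Set G) := by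
  induction n generalizing i with
  | zero => exact hY i
  | succ n ih =>
    have n1 := polarSubgroup_normal hH n (leftIdx n (i / 2))
    have n2 := polarSubgroup_normal hH n (leftIdx n (i / 2) + 2 ^ n)
    have c1 := ih (leftIdx n (i / 2))
    have c2 := ih (leftIdx n (i / 2) + 2 ^ n)
    rcases Nat.mod_two_eq_zero_or_one i with hi | hi
    · simp only [polarY, polarSubgroup, polarU, hi, if_true, FinCoset.mul]
      rw [c1, c2, Subgroup.mul_normal]
      generalize polarU X n _ ω = a at *
      generalize polarU X n _ ω = b at *
      generalize polarSubgroup H n _ = K at *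
      generalize polarSubgroup H n _ = L at *
      ext x
      simp only [Set.mem_mul, Set.mem_smul_set, smul_eq_mul, SetLike.mem_coe]
      constructor
      · rintro ⟨_, ⟨h, hh, rfl⟩, _, ⟨k, hk, rfl⟩, rfl⟩
        refine ⟨(b⁻¹ * h * b) * k, ⟨b⁻¹ * h * b, ?_, k, hk, rfl⟩, by group⟩
        simpa using n1.conj_mem h hh b⁻¹
      · rintro ⟨_, ⟨h, hh, k, hk, rfl⟩, rfl⟩
        exact ⟨a * (b * h * b⁻¹), ⟨b * h * b⁻¹, n1.conj_mem h hh b, rfl⟩, b * k, ⟨k, hk, rfl⟩,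
          by group⟩
    · have hi' : (i - 1) % 2 = 0 := by omega
      have hi'' : (i - 1) / 2 = i / 2 := by omega
      have hne : ¬ (1 : ℕ) = 0 := one_ne_zero
      simp only [polarY, polarSubgroup, polarU, hi, hi', hi'', if_true, if_neg hne]
      generalize polarU X n _ ω = a at *
      generalize polarU X n _ ω = b at *
      generalize polarSubgroup H n _ = K at *
      generalize polarSubgroup H n _ = L at *
      have key := FinCoset.phi_eq (a * b) a b K L n1 _ _ c1 c2
      rw [inv_mul_cancel_left, ← Set.smul_set_inter] at key
      have hne : (FinCoset.phi (a * b) (polarY X Y n (leftIdx n (i / 2)) ω)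
          (polarY X Y n (leftIdx n (i / 2) + 2 ^ n) ω)).Nonempty := by
        rw [key]
        exact ⟨b • 1, Set.smul_mem_smul_set ⟨K.one_mem, L.one_mem⟩⟩
      rw [FinCoset.plus, dif_pos hne]
      exact key

/-! ### Fibres of the transform over prefixes of the output -/

/-- The outputs of a block are functions of the inputs of the same block. -/
theorem polarMap_block_congr {n m : ℕ} {x x' : ℕ → G}
    (h : ∀ s < 2 ^ n, x (m * 2 ^ n + s) = x' (m * 2 ^ n + s)) {r : ℕ} (hr : r < 2 ^ n) :
    polarMap n (m * 2 ^ n + r) x = polarMap n (m * 2 ^ n + r) x' := by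
  induction n generalizing m r with
  | zero => exact h r hr
  | succ n ih =>
    have h1 : ∀ q < 2 ^ n,
        polarMap n (2 * m * 2 ^ n + q) x = polarMap n (2 * m * 2 ^ n + q) x' := fun q hq => by
      refine ih (fun s hs => ?_) hq
      have := h s (by rw [pow_succ]; omega)
      rwa [show m * 2 ^ (n + 1) + s = 2 * m * 2 ^ n + s by ring] at this
    have h2 : ∀ q < 2 ^ n, polarMap n ((2 * m + 1) * 2 ^ n + q) x =
        polarMap n ((2 * m + 1) * 2 ^ n + q) x' := fun q hq => by
      refine ih (fun s hs => ?_) hq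
      have := h (2 ^ n + s) (by rw [pow_succ]; omega)
      rwa [show m * 2 ^ (n + 1) + (2 ^ n + s) = (2 * m + 1) * 2 ^ n + s by ring] at this
    rw [pow_succ] at hr
    obtain ⟨q, rfl | rfl⟩ := Nat.even_or_odd' r
    · rw [polarMap_block_even m (by omega), polarMap_block_even m (by omega),
        h1 q (by omega), h2 q (by omega)]
    · rw [polarMap_block_odd m (by omega), polarMap_block_odd m (by omega), h2 q (by omega)]

/-- The transform is injective on each block. -/
theorem eq_of_polarMap_block_eq {n m : ℕ} {x x' : ℕ → G}
    (h : ∀ r < 2 ^ n, polarMap n (m * 2 ^ n + r) x = polarMap n (m * 2 ^ n + r) x') {s : ℕ}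
    (hs : s < 2 ^ n) : x (m * 2 ^ n + s) = x' (m * 2 ^ n + s) := by
  induction n generalizing m s with
  | zero => exact h s hs
  | succ n ih =>
    have h2 : ∀ q < 2 ^ n, polarMap n ((2 * m + 1) * 2 ^ n + q) x =
        polarMap n ((2 * m + 1) * 2 ^ n + q) x' := fun q hq => by
      have := h (2 * q + 1) (by rw [pow_succ]; omega)
      rwa [polarMap_block_odd m hq, polarMap_block_odd m hq] at this
    have h1 : ∀ q < 2 ^ n,
        polarMap n (2 * m * 2 ^ n + q) x = polarMap n (2 * m * 2 ^ n + q) x' := fun q hq => by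
      have := h (2 * q) (by rw [pow_succ]; omega)
      rw [polarMap_block_even m hq, polarMap_block_even m hq, h2 q hq] at this
      exact mul_right_cancel this
    rw [pow_succ] at hs
    rcases lt_or_ge s (2 ^ n) with hlt | hge
    · have := ih h1 hlt
      rwa [show 2 * m * 2 ^ n + s = m * 2 ^ (n + 1) + s by ring] at this
    · obtain ⟨s, rfl⟩ := Nat.exists_eq_add_of_le hge
      have := ih (s := s) h2 (by omega)
      rwa [show (2 * m + 1) * 2 ^ n + s = m * 2 ^ (n + 1) + (2 ^ n + s) by ring] at this

/-- Inputs in the same cosets whose outputs agree before position `r` of a block have `r`-th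
outputs in the same coset. -/
theorem inv_polarMap_mul_mem {H : ℕ → Subgroup G} (hH : ∀ j, (H j).Normal) {x x' : ℕ → G}
    (hx : ∀ j, (x j)⁻¹ * x' j ∈ H j) {n m r : ℕ} (hr : r < 2 ^ n)
    (h : ∀ t < r, polarMap n (m * 2 ^ n + t) x' = polarMap n (m * 2 ^ n + t) x) :
    (polarMap n (m * 2 ^ n + r) x)⁻¹ * polarMap n (m * 2 ^ n + r) x' ∈
      polarSubgroup H n (m * 2 ^ n + r) := by
  induction n generalizing m r with
  | zero => exact hx _
  | succ n ih =>
    obtain ⟨q, hq⟩ := Nat.even_or_odd' r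
    have hqn : q < 2 ^ n := by rw [pow_succ] at hr; omega
    have e2 : ∀ t < q, polarMap n ((2 * m + 1) * 2 ^ n + t) x' =
        polarMap n ((2 * m + 1) * 2 ^ n + t) x := fun t ht => by
      have := h (2 * t + 1) (by omega)
      rwa [polarMap_block_odd m (by omega), polarMap_block_odd m (by omega)] at this
    have e1 : ∀ t < q, polarMap n (2 * m * 2 ^ n + t) x' =
        polarMap n (2 * m * 2 ^ n + t) x := fun t ht => by
      have := h (2 * t) (by omega)
      rw [polarMap_block_even m (by omega), polarMap_block_even m (by omega), e2 t ht] at this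
      exact mul_right_cancel this
    have i1 := ih hqn e1
    have i2 := ih hqn e2
    have n1 := polarSubgroup_normal hH n (2 * m * 2 ^ n + q)
    have n2 := polarSubgroup_normal hH n ((2 * m + 1) * 2 ^ n + q)
    rcases hq with rfl | rfl
    · rw [polarMap_block_even m hqn, polarMap_block_even m hqn, polarSubgroup_block_even m hqn]
      generalize polarMap n _ x = a at *
      generalize polarMap n _ x' = a' at *
      generalize polarMap n _ x = b at *
      generalize polarMap n _ x' = b' at *
      have := Subgroup.mul_mem_sup (n1.conj_mem _ i1 b⁻¹) i2
      convert this using 1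
      group
    · have e := h (2 * q) (by omega)
      rw [polarMap_block_even m hqn, polarMap_block_even m hqn] at e
      rw [polarMap_block_odd m hqn, polarMap_block_odd m hqn, polarSubgroup_block_odd m hqn]
      generalize polarMap n _ x = a at *
      generalize polarMap n _ x' = a' at *
      generalize polarMap n _ x = b at *
      generalize polarMap n _ x' = b' at *
      refine Subgroup.mem_inf.2 ⟨?_, i2⟩
      have := n1.conj_mem _ (inv_mem i1) b⁻¹
      convert this using 1
      rw [eq_inv_mul_of_mul_eq e]
      group

/-- Every element of the coset of the `r`-th output of a block is realized by inputs in the same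
cosets, without changing the previous outputs and the inputs of the other blocks. -/
theorem exists_polarMap_eq_mul {H : ℕ → Subgroup G} (hH : ∀ j, (H j).Normal) {n m r : ℕ}
    (hr : r < 2 ^ n) (x : ℕ → G) {h : G} (hh : h ∈ polarSubgroup H n (m * 2 ^ n + r)) :
    ∃ x' : ℕ → G, (∀ j, (x j)⁻¹ * x' j ∈ H j) ∧ (∀ j, j / 2 ^ n ≠ m → x' j = x j) ∧
      (∀ t < r, polarMap n (m * 2 ^ n + t) x' = polarMap n (m * 2 ^ n + t) x) ∧
      polarMap n (m * 2 ^ n + r) x' = polarMap n (m * 2 ^ n + r) x * h := by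
  induction n generalizing m r x h with
  | zero =>
    obtain rfl : r = 0 := by simpa using hr
    simp only [pow_zero, mul_one, add_zero, Nat.div_one] at hh ⊢
    have hh : h ∈ H m := hh
    refine ⟨Function.update x m (x m * h), fun j => ?_, fun j hj => by simp [hj], by simp,
      by simp [polarMap_zero]⟩
    rcases eq_or_ne j m with rfl | hj
    · simpa using hh
    · simp [hj, (H j).one_mem]
  | succ n ih =>
    obtain ⟨q, hq⟩ := Nat.even_or_odd' r
    have hqn : q < 2 ^ n := by rw [pow_succ] at hr; omega
    have n1 := polarSubgroup_normal hH n (2 * m * 2 ^ n + q)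
    have n2 := polarSubgroup_normal hH n ((2 * m + 1) * 2 ^ n + q)
    -- The two halves of the block can be changed independently of each other.
    have both : ∀ h1 ∈ polarSubgroup H n (2 * m * 2 ^ n + q),
        ∀ h2 ∈ polarSubgroup H n ((2 * m + 1) * 2 ^ n + q), ∃ x' : ℕ → G,
          (∀ j, (x j)⁻¹ * x' j ∈ H j) ∧ (∀ j, j / 2 ^ (n + 1) ≠ m → x' j = x j) ∧
          (∀ t < 2 * q, polarMap (n + 1) (m * 2 ^ (n + 1) + t) x' =
            polarMap (n + 1) (m * 2 ^ (n + 1) + t) x) ∧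
          polarMap n (2 * m * 2 ^ n + q) x' = polarMap n (2 * m * 2 ^ n + q) x * h1 ∧
          polarMap n ((2 * m + 1) * 2 ^ n + q) x' =
            polarMap n ((2 * m + 1) * 2 ^ n + q) x * h2 := by
      intro h1 hh1 h2 hh2
      obtain ⟨y, hy, hyo, hyt, hyq⟩ := ih hqn x hh1
      obtain ⟨z, hz, hzo, hzt, hzq⟩ := ih hqn y hh2
      have dv : ∀ k s : ℕ, s < 2 ^ n → (k * 2 ^ n + s) / 2 ^ n = k := fun k s hs => by
        rw [mul_comm, Nat.mul_add_div (by positivity), Nat.div_eq_of_lt hs, add_zero]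
      have l1 : ∀ t < 2 ^ n,
          polarMap n (2 * m * 2 ^ n + t) z = polarMap n (2 * m * 2 ^ n + t) y := fun t ht =>
        polarMap_block_congr (fun s hs => hzo _ (by rw [dv _ _ hs]; omega)) ht
      have l2 : ∀ t < 2 ^ n, polarMap n ((2 * m + 1) * 2 ^ n + t) y =
          polarMap n ((2 * m + 1) * 2 ^ n + t) x := fun t ht =>
        polarMap_block_congr (fun s hs => hyo _ (by rw [dv _ _ hs]; omega)) ht
      refine ⟨z, fun j => ?_, fun j hj => ?_, fun t ht => ?_, ?_, ?_⟩
      · have := mul_mem (hy j) (hz j)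
        rwa [mul_assoc, mul_inv_cancel_left] at this
      · have e : j / 2 ^ (n + 1) = j / 2 ^ n / 2 := by rw [pow_succ, Nat.div_div_eq_div_mul]
        rw [hzo j (by omega), hyo j (by omega)]
      · obtain ⟨p, rfl | rfl⟩ := Nat.even_or_odd' t
        · rw [polarMap_block_even m (by omega), polarMap_block_even m (by omega),
            l1 p (by omega), hyt p (by omega), hzt p (by omega), l2 p (by omega)]
        · rw [polarMap_block_odd m (by omega), polarMap_block_odd m (by omega),
            hzt p (by omega), l2 p (by omega)]
      · rw [l1 q hqn, hyq]
      · rw [hzq, l2 q hqn]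
    rcases hq with rfl | rfl
    · rw [polarSubgroup_block_even m hqn, ← SetLike.mem_coe, Subgroup.mul_normal] at hh
      obtain ⟨h1, hh1, h2, hh2, rfl⟩ := hh
      -- Moving `h1` to the left of the second factor conjugates it.
      obtain ⟨x', a, b, c, d, e⟩ :=
        both _ (n1.conj_mem h1 hh1 (polarMap n ((2 * m + 1) * 2 ^ n + q) x)) h2 hh2
      refine ⟨x', a, b, c, ?_⟩
      rw [polarMap_block_even m hqn, polarMap_block_even m hqn, d, e]
      group
    · rw [polarSubgroup_block_odd m hqn] at hh
      -- The first factor compensates, so that the product, the previous output, is unchanged.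
      obtain ⟨x', a, b, c, d, e⟩ :=
        both _ (n1.conj_mem _ (inv_mem hh.1) (polarMap n ((2 * m + 1) * 2 ^ n + q) x)) h hh.2
      refine ⟨x', a, b, fun t ht => ?_, ?_⟩
      · rcases Nat.lt_succ_iff_lt_or_eq.1 ht with ht | rfl
        · exact c t ht
        · rw [polarMap_block_even m hqn, polarMap_block_even m hqn, d, e]
          group
      · rw [polarMap_block_odd m hqn, polarMap_block_odd m hqn, e]

/-- The input sequences that lie in the same cosets as `x` and differ from it only before `M`. -/
def cosetBox (H : ℕ → Subgroup G) (M : ℕ) (x : ℕ → G) : Set (ℕ → G) :=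
  {x' | (∀ j, (x j)⁻¹ * x' j ∈ H j) ∧ ∀ j, M ≤ j → x' j = x j}

theorem self_mem_cosetBox (H : ℕ → Subgroup G) (M : ℕ) (x : ℕ → G) : x ∈ cosetBox H M x :=
  ⟨fun j => by simp [(H j).one_mem], fun _ _ => rfl⟩

theorem cosetBox_finite {H : ℕ → Subgroup G} (fH : ∀ j, (H j : Set G).Finite) (M : ℕ)
    (x : ℕ → G) : (cosetBox H M x).Finite := by
  have hp : (Set.univ.pi fun j : Fin M => x j • (H j : Set G)).Finite :=
    Set.Finite.pi fun j => (fH j).smul_set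
  refine Set.Finite.of_finite_image (f := fun x' (j : Fin M) => x' j) (hp.subset ?_) ?_
  · rintro _ ⟨x', hx', rfl⟩ j -
    exact Set.mem_smul_set_iff_inv_smul_mem.2 (hx'.1 j)
  · intro y hy z hz hyz
    ext j
    rcases lt_or_ge j M with hj | hj
    · exact congrFun hyz ⟨j, hj⟩
    · rw [hy.2 j hj, hz.2 j hj]

theorem cosetBox_eq_of_mem {H : ℕ → Subgroup G} {M : ℕ} {x y : ℕ → G}
    (hy : y ∈ cosetBox H M x) : cosetBox H M y = cosetBox H M x := by
  ext z
  refine ⟨fun hz => ⟨fun j => ?_, fun j hj => (hz.2 j hj).trans (hy.2 j hj)⟩,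
    fun hz => ⟨fun j => ?_, fun j hj => (hz.2 j hj).trans (hy.2 j hj).symm⟩⟩
  · have := mul_mem (hy.1 j) (hz.1 j)
    rwa [mul_assoc, mul_inv_cancel_left] at this
  · have := mul_mem (inv_mem (hy.1 j)) (hz.1 j)
    rwa [mul_inv_rev, inv_inv, mul_assoc, mul_inv_cancel_left] at this

/-- The elements of the box of `x` whose first `i` outputs are those of `x`. -/
def prefixFiber (n : ℕ) (H : ℕ → Subgroup G) (M i : ℕ) (x : ℕ → G) : Set (ℕ → G) :=
  {x' ∈ cosetBox H M x | ∀ k < i, polarMap n k x' = polarMap n k x}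

theorem prefixFiber_finite {H : ℕ → Subgroup G} (fH : ∀ j, (H j : Set G).Finite)
    (n M i : ℕ) (x : ℕ → G) : (prefixFiber n H M i x).Finite :=
  (cosetBox_finite fH M x).subset fun _ h => h.1

theorem inv_polarMap_mul_mem_of_mem_prefixFiber {H : ℕ → Subgroup G} (hH : ∀ j, (H j).Normal)
    {n M i : ℕ} {x x' : ℕ → G} (hx' : x' ∈ prefixFiber n H M i x) :
    (polarMap n i x)⁻¹ * polarMap n i x' ∈ polarSubgroup H n i := by
  have e := Nat.div_add_mod' i (2 ^ n)
  have hr : i % 2 ^ n < 2 ^ n := Nat.mod_lt _ (by positivity)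
  have := inv_polarMap_mul_mem hH hx'.1.1 (m := i / 2 ^ n) hr
    fun t ht => hx'.2 _ (by omega)
  rwa [e] at this

/-- Prescribing an admissible next output turns a fibre over a prefix into a fibre over a prefix
longer by one, with another base point. -/
theorem exists_prefixFiber_succ_eq {H : ℕ → Subgroup G} (hH : ∀ j, (H j).Normal) {n L i : ℕ}
    (hi : i < L * 2 ^ n) {x : ℕ → G} {v : G}
    (hv : (polarMap n i x)⁻¹ * v ∈ polarSubgroup H n i) :
    ∃ y, {x' ∈ prefixFiber n H (L * 2 ^ n) i x | polarMap n i x' = v} =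
      prefixFiber n H (L * 2 ^ n) (i + 1) y := by
  have e := Nat.div_add_mod' i (2 ^ n)
  have hr : i % 2 ^ n < 2 ^ n := Nat.mod_lt _ (by positivity)
  have hm : i / 2 ^ n < L := Nat.div_lt_of_lt_mul (by rwa [mul_comm])
  rw [← e] at hv
  obtain ⟨y, hy, hyo, hyt, hyi⟩ := exists_polarMap_eq_mul hH hr x hv
  rw [mul_inv_cancel_left, e] at hyi
  have hyM : y ∈ cosetBox H (L * 2 ^ n) x := by
    refine ⟨hy, fun j hj => hyo j ?_⟩
    have := (Nat.le_div_iff_mul_le (by positivity : 0 < 2 ^ n)).2 hj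
    omega
  have hyk : ∀ k < i, polarMap n k y = polarMap n k x := fun k hk => by
    have ek := Nat.div_add_mod' k (2 ^ n)
    have hkm : k / 2 ^ n ≤ i / 2 ^ n := Nat.div_le_div_right hk.le
    rcases hkm.lt_or_eq with hlt | heq
    · rw [← ek]
      refine polarMap_block_congr (fun s hs => hyo _ ?_) (Nat.mod_lt _ (by positivity))
      rw [mul_comm, Nat.mul_add_div (by positivity), Nat.div_eq_of_lt hs]
      omega
    · rw [heq] at ek
      rw [← ek]
      exact hyt _ (by omega)
  refine ⟨y, ?_⟩
  ext z
  simp only [prefixFiber, Set.mem_ofPred_eq, cosetBox_eq_of_mem hyM, Nat.lt_succ_iff_lt_or_eq]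
  constructor
  · rintro ⟨⟨hz, hzk⟩, hzi⟩
    refine ⟨hz, ?_⟩
    rintro k (hk | rfl)
    · rw [hzk k hk, hyk k hk]
    · rw [hzi, hyi]
  · rintro ⟨hz, hzk⟩
    exact ⟨⟨hz, fun k hk => by rw [hzk k (Or.inl hk), hyk k hk]⟩, by rw [hzk i (Or.inr rfl), hyi]⟩

/-- The number of completions of a prefix depends on the subgroups only. -/
theorem ncard_prefixFiber {H : ℕ → Subgroup G} (hH : ∀ j, (H j).Normal)
    (fH : ∀ j, (H j : Set G).Finite) {n L i : ℕ} (hi : i ≤ L * 2 ^ n) (x : ℕ → G) :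
    (prefixFiber n H (L * 2 ^ n) i x).ncard =
      ∏ k ∈ Finset.Ico i (L * 2 ^ n), (polarSubgroup H n k : Set G).ncard := by
  classical
  induction hi using Nat.decreasingInduction generalizing x with
  | self =>
    rw [Finset.Ico_self, Finset.prod_empty, Set.ncard_eq_one]
    refine ⟨x, Set.Subset.antisymm (fun y hy => ?_) ?_⟩
    · ext j
      rcases lt_or_ge j (L * 2 ^ n) with hj | hj
      · rw [← Nat.div_add_mod' j (2 ^ n)]
        have hm : j / 2 ^ n < L := Nat.div_lt_of_lt_mul (by rwa [mul_comm])
        refine eq_of_polarMap_block_eq (fun r hr => hy.2 _ ?_) (Nat.mod_lt _ (by positivity))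
        calc j / 2 ^ n * 2 ^ n + r < (j / 2 ^ n + 1) * 2 ^ n := by rw [add_mul]; omega
          _ ≤ L * 2 ^ n := Nat.mul_le_mul_right _ hm
      · exact hy.1.2 j hj
    · rintro _ rfl
      exact ⟨self_mem_cosetBox _ _ _, fun _ _ => rfl⟩
  | of_succ i hi ih =>
    have hfin := prefixFiber_finite fH n (L * 2 ^ n) i x
    have hcos : (polarMap n i x • (polarSubgroup H n i : Set G)).Finite :=
      (polarSubgroup_finite hH fH n i).smul_set
    have maps : ∀ x' ∈ hfin.toFinset, polarMap n i x' ∈ hcos.toFinset := fun x' hx' => by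
      rw [Set.Finite.mem_toFinset] at hx' ⊢
      exact Set.mem_smul_set_iff_inv_smul_mem.2
        (inv_polarMap_mul_mem_of_mem_prefixFiber hH hx')
    rw [Set.ncard_eq_toFinset_card _ hfin, Finset.card_eq_sum_card_fiberwise maps,
      Finset.prod_eq_prod_Ico_succ_bot hi]
    have hc : ∀ v ∈ hcos.toFinset, (hfin.toFinset.filter fun x' => polarMap n i x' = v).card =
        ∏ k ∈ Finset.Ico (i + 1) (L * 2 ^ n), (polarSubgroup H n k : Set G).ncard := by
      intro v hv
      rw [Set.Finite.mem_toFinset, Set.mem_smul_set_iff_inv_smul_mem] at hv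
      obtain ⟨y, hy⟩ := exists_prefixFiber_succ_eq hH hi hv
      rw [← ih y, ← hy, ← Set.ncard_coe_finset]
      congr 1
      ext z
      simp
    rw [Finset.sum_congr rfl hc, Finset.sum_const, smul_eq_mul,
      ← Set.ncard_eq_toFinset_card _ hcos, Set.ncard_smul_set]

end Deterministic

/-! ### Joint laws and product kernels -/

section ProductKernel

variable {F : Type*} [MeasurableSpace F] {ι : Type*} [Fintype ι] {E : ι → Type*}
  [∀ j, MeasurableSpace (E j)]

/-- The product of finitely many Markov kernels: given `y`, the coordinates are independent with
laws `κ j y`. -/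
noncomputable def kernelPi (κ : (j : ι) → Kernel F (E j)) [∀ j, IsMarkovKernel (κ j)] :
    Kernel F ((j : ι) → E j) where
  toFun y := Measure.pi fun j => κ j y
  measurable' := by
    refine Measurable.measure_of_isPiSystem_of_isProbabilityMeasure generateFrom_pi.symm
      isPiSystem_pi ?_
    rintro _ ⟨t, ht, rfl⟩
    simp only [Measure.pi_pi]
    exact Finset.measurable_prod _ fun j _ => Kernel.measurable_coe _ (ht j trivial)

theorem kernelPi_apply (κ : (j : ι) → Kernel F (E j)) [∀ j, IsMarkovKernel (κ j)] (y : F) :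
    kernelPi κ y = Measure.pi fun j => κ j y := rfl

instance (κ : (j : ι) → Kernel F (E j)) [∀ j, IsMarkovKernel (κ j)] :
    IsMarkovKernel (kernelPi κ) :=
  ⟨fun y => by rw [kernelPi_apply]; infer_instance⟩

end ProductKernel

/-- If the pairs `(X j, Y j)` are independent, then `X 0, …, X (M - 1)` are conditionally
independent given the whole sequence `Y`, and the conditional law of `X j` involves `Y j` only. -/
theorem map_prodMk_eq_compProd_kernelPi {Ω G F : Type*} [MeasurableSpace Ω] [MeasurableSpace G]
    [MeasurableSpace F] {μ : Measure Ω} [IsProbabilityMeasure μ] {X : ℕ → Ω → G}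
    {Y : ℕ → Ω → F} (hX : ∀ j, Measurable (X j)) (hY : ∀ j, Measurable (Y j))
    (hindep : iIndepFun (fun j ω => (X j ω, Y j ω)) μ) (κ : ℕ → Kernel F G)
    [∀ j, IsMarkovKernel (κ j)]
    (hκ : ∀ j, μ.map (fun ω => (Y j ω, X j ω)) = μ.map (Y j) ⊗ₘ κ j) (M : ℕ) :
    μ.map (fun ω => ((fun j => Y j ω), fun j : Fin M => X j ω)) =
      μ.map (fun ω j => Y j ω) ⊗ₘ
        kernelPi (fun j : Fin M => (κ j).comap (fun y : ℕ → F => y j) (measurable_pi_apply _)) := by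
  classical
  have hYm : Measurable fun ω j => Y j ω := measurable_pi_lambda _ hY
  have hXm : Measurable fun ω (j : Fin M) => X j ω := measurable_pi_lambda _ fun j => hX j
  have : IsProbabilityMeasure (μ.map fun ω j => Y j ω) :=
    Measure.isProbabilityMeasure_map hYm.aemeasurable
  have : IsProbabilityMeasure (μ.map fun ω => ((fun j => Y j ω), fun j : Fin M => X j ω)) :=
    Measure.isProbabilityMeasure_map (hYm.prodMk hXm).aemeasurable
  have hgen := generateFrom_eq_prod (α := ℕ → F) (β := Fin M → G) generateFrom_squareCylinders
    generateFrom_pi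
    ⟨fun _ => Set.univ, fun _ => ⟨∅, fun _ => Set.univ, fun _ _ => MeasurableSet.univ, by simp⟩,
      Set.iUnion_const _⟩
    ⟨fun _ => Set.univ, fun _ => ⟨fun _ => Set.univ, fun _ _ => MeasurableSet.univ, by simp⟩,
      Set.iUnion_const _⟩
  refine ext_of_generate_finite _ hgen.symm
    ((isPiSystem_squareCylinders (fun _ => MeasurableSpace.isPiSystem_measurableSet)
      fun _ => MeasurableSet.univ).prod isPiSystem_pi) ?_ (by simp)
  rintro _ ⟨_, ⟨s, t, ht, rfl⟩, _, ⟨A, hA, rfl⟩, rfl⟩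
  have ht : ∀ k, MeasurableSet (t k) := fun k => ht k trivial
  have hA : ∀ j, MeasurableSet (A j) := fun j => hA j trivial
  -- Both sides are products over the finite set `T` of all the coordinates that occur.
  set T := s ∪ Finset.range M with hT
  let B' : ℕ → Set F := fun k => if k ∈ s then t k else Set.univ
  let A' : ℕ → Set G := fun k => if h : k < M then A ⟨k, h⟩ else Set.univ
  have hB' : ∀ k, MeasurableSet (B' k) := fun k => by
    by_cases h : k ∈ s <;> simp [B', h, ht]
  have hA' : ∀ k, MeasurableSet (A' k) := fun k => by
    by_cases h : k < M <;> simp [A', h, hA]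
  have hbox : MeasurableSet ((s : Set ℕ).pi t) :=
    MeasurableSet.pi s.countable_toSet fun k _ => ht k
  have hφ : ∀ k, Measurable ((B' k).indicator fun y => κ k y (A' k)) := fun k =>
    (Kernel.measurable_coe _ (hA' k)).indicator (hB' k)
  have left : (fun ω => ((fun j => Y j ω), fun j : Fin M => X j ω)) ⁻¹'
      ((s : Set ℕ).pi t ×ˢ Set.univ.pi A) =
      ⋂ k ∈ T, (fun ω => (X k ω, Y k ω)) ⁻¹' (A' k ×ˢ B' k) := by
    ext ω
    simp only [Set.mem_preimage, Set.mem_prod, Set.mem_pi, Set.mem_iInter, Finset.mem_coe,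
      Set.mem_univ, true_imp_iff]
    constructor
    · rintro ⟨h1, h2⟩ k -
      refine ⟨?_, ?_⟩
      · by_cases h : k < M
        · simpa [A', h] using h2 ⟨k, h⟩
        · simp [A', h]
      · by_cases h : k ∈ s
        · simpa [B', h] using h1 k h
        · simp [B', h]
    · intro h
      refine ⟨fun k hk => ?_, fun j => ?_⟩
      · simpa [B', hk] using (h k (by simp [hT, hk])).2
      · simpa [A'] using (h j (by simp [hT])).1
  have right : ∀ y : ℕ → F, ((s : Set ℕ).pi t).indicator
      (fun y => ∏ j : Fin M, κ j (y j) (A j)) y =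
      ∏ k ∈ T, (B' k).indicator (fun y => κ k y (A' k)) (y k) := by
    intro y
    by_cases hy : y ∈ (s : Set ℕ).pi t
    · have e : ∀ k ∈ T, (B' k).indicator (fun y => κ k y (A' k)) (y k) = κ k (y k) (A' k) := by
        intro k _
        refine Set.indicator_of_mem ?_ _
        by_cases h : k ∈ s
        · simpa [B', h] using hy k h
        · simp [B', h]
      rw [Set.indicator_of_mem hy, Finset.prod_congr rfl e,
        ← Finset.prod_subset (s₁ := Finset.range M) Finset.subset_union_right,
        Finset.prod_range]
      · simp [A']
      · intro k _ hk
        have : ¬ k < M := by simpa using hk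
        simp [A', this]
    · rw [Set.indicator_of_notMem hy]
      simp only [Set.mem_pi, not_forall, Finset.mem_coe] at hy
      obtain ⟨k, hk, hyk⟩ := hy
      refine (Finset.prod_eq_zero (i := k) (by simp [hT, hk]) ?_).symm
      exact Set.indicator_of_notMem (by simpa [B', hk] using hyk) _
  have one : ∀ k, μ ((fun ω => (X k ω, Y k ω)) ⁻¹' (A' k ×ˢ B' k)) =
      ∫⁻ ω, (B' k).indicator (fun y => κ k y (A' k)) (Y k ω) ∂μ := by
    intro k
    have := congrArg (fun ν => ν (B' k ×ˢ A' k)) (hκ k)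
    rw [Measure.map_apply ((hY k).prodMk (hX k)) ((hB' k).prod (hA' k)),
      Measure.compProd_apply_prod (hB' k) (hA' k), ← lintegral_indicator (hB' k),
      lintegral_map (hφ k) (hY k)] at this
    rw [← this]
    congr 1
    ext ω
    simp [and_comm]
  have hind : iIndepFun (fun k ω => (B' k).indicator (fun y => κ k y (A' k)) (Y k ω)) μ :=
    hindep.comp (fun k p => (B' k).indicator (fun y => κ k y (A' k)) p.2)
      fun k => (hφ k).comp measurable_snd
  rw [Measure.map_apply (hYm.prodMk hXm) (hbox.prod (MeasurableSet.univ_pi hA)), left,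
    hindep.measure_inter_preimage_eq_mul T fun k _ => (hA' k).prod (hB' k),
    Measure.compProd_apply_prod hbox (MeasurableSet.univ_pi hA), ← lintegral_indicator hbox,
    lintegral_map ((Kernel.measurable_coe _ (MeasurableSet.univ_pi hA)).indicator hbox) hYm,
    Finset.prod_congr rfl fun k _ => one k,
    ← lintegral_prod_eq_prod_lintegral_of_indepFun T _ hind fun k => (hφ k).comp (hY k)]
  refine lintegral_congr fun ω => ?_
  rw [← right fun j => Y j ω]
  simp [kernelPi_apply, Measure.pi_pi, Kernel.comap_apply]

/-! ### Conditioning a discrete conditional law further -/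

section Fiber

variable {E F W V : Type*} [MeasurableSpace E] [MeasurableSpace F] [MeasurableSpace W]
  [MeasurableSpace V] [MeasurableEq W]

/-- If `q y` is the law of `Z` given `Y = y`, this is the law of `f Z` given `g Z = w` and `Y = y`,
provided that `q y` is discrete: `q y` is conditioned on `g ⁻¹' {w}` in the elementary way. It is the
zero measure where `q y (g ⁻¹' {w}) = 0`. -/
noncomputable def fiberKernel (q : Kernel F E) [IsMarkovKernel q] {g : E → W} (hg : Measurable g)
    {f : E → V} (hf : Measurable f) : Kernel (W × F) V where
  toFun p := ((q p.2)[|g ⁻¹' {p.1}]).map f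
  measurable' := by
    refine Measure.measurable_of_measurable_coe _ fun B hB => ?_
    simp only [Measure.map_apply hf hB, cond_apply (hg (measurableSet_singleton _))]
    have key : ∀ C : Set E, MeasurableSet C →
        Measurable fun p : W × F => q p.2 (g ⁻¹' {p.1} ∩ C) := fun C hC => by
      have hm : MeasurableSet {r : (W × F) × E | g r.2 = r.1.1 ∧ r.2 ∈ C} :=
        (measurableSet_eq_fun (hg.comp measurable_snd) (measurable_fst.comp measurable_fst)).inter
          (measurable_snd hC)
      exact Kernel.measurable_kernel_prodMk_left (κ := q.comap Prod.snd measurable_snd) hm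
    have h1 := key Set.univ MeasurableSet.univ
    simp only [Set.inter_univ] at h1
    exact h1.inv.mul (key _ (hf hB))

theorem fiberKernel_apply (q : Kernel F E) [IsMarkovKernel q] {g : E → W} (hg : Measurable g)
    {f : E → V} (hf : Measurable f) (p : W × F) :
    fiberKernel q hg hf p = ((q p.2)[|g ⁻¹' {p.1}]).map f := rfl

instance (q : Kernel F E) [IsMarkovKernel q] {g : E → W} (hg : Measurable g)
    {f : E → V} (hf : Measurable f) : IsFiniteKernel (fiberKernel q hg hf) :=
  ⟨1, ENNReal.one_lt_top, fun p => by
    rw [fiberKernel_apply, Measure.map_apply hf MeasurableSet.univ]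
    exact prob_le_one⟩

/-- The law of total probability for a finitely supported measure. -/
theorem lintegral_inv_mul_measure_fiber [MeasurableSingletonClass E] (q : Measure E)
    [IsProbabilityMeasure q] {S : Finset E} (hS : q (S : Set E)ᶜ = 0) {g : E → W}
    (hg : Measurable g) (D : Set W) (B : Set E) :
    ∫⁻ z, D.indicator (fun w => (q (g ⁻¹' {w}))⁻¹ * q (g ⁻¹' {w} ∩ B)) (g z) ∂q =
      q (g ⁻¹' D ∩ B) := by
  classical
  have hqS : q.restrict S = q := Measure.restrict_eq_self_of_ae_mem hS
  have hw : ∀ w, MeasurableSet (g ⁻¹' {w}) := fun w => hg (measurableSet_singleton w)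
  have fib : ∀ w, ∑ z ∈ S with g z = w, q {z} = q (g ⁻¹' {w}) := fun w => by
    rw [sum_measure_singleton]
    nth_rewrite 2 [← hqS]
    rw [Measure.restrict_apply (hw w)]
    congr 1
    ext z
    simp [and_comm]
  nth_rewrite 1 [← hqS]
  rw [lintegral_finset, ← Finset.sum_fiberwise_of_maps_to (t := S.image g)
    fun z hz => Finset.mem_image_of_mem g hz]
  have term : ∀ w, ∑ z ∈ S with g z = w,
      D.indicator (fun w => (q (g ⁻¹' {w}))⁻¹ * q (g ⁻¹' {w} ∩ B)) (g z) * q {z} =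
      q.restrict (g ⁻¹' D ∩ B) (g ⁻¹' {w}) := fun w => by
    have e : ∀ z ∈ S.filter (g · = w),
        D.indicator (fun w => (q (g ⁻¹' {w}))⁻¹ * q (g ⁻¹' {w} ∩ B)) (g z) * q {z} =
        D.indicator (fun w => (q (g ⁻¹' {w}))⁻¹ * q (g ⁻¹' {w} ∩ B)) w * q {z} := fun z hz => by
      rw [(Finset.mem_filter.1 hz).2]
    rw [Finset.sum_congr rfl e, ← Finset.mul_sum, fib, Measure.restrict_apply (hw w)]
    by_cases hwD : w ∈ D
    · have e : g ⁻¹' {w} ∩ (g ⁻¹' D ∩ B) = g ⁻¹' {w} ∩ B := by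
        ext z
        simp only [Set.mem_inter_iff, Set.mem_preimage, Set.mem_singleton_iff]
        constructor
        · rintro ⟨h1, h2, h3⟩
          exact ⟨h1, h3⟩
        · rintro ⟨rfl, h3⟩
          exact ⟨rfl, hwD, h3⟩
      rw [Set.indicator_of_mem hwD, e]
      by_cases h0 : q (g ⁻¹' {w}) = 0
      · rw [h0, mul_zero, measure_mono_null Set.inter_subset_left h0]
      · rw [mul_comm, ← mul_assoc, ENNReal.mul_inv_cancel h0 (measure_ne_top _ _), one_mul]
    · have e : g ⁻¹' {w} ∩ (g ⁻¹' D ∩ B) = ∅ := by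
        ext z
        simp only [Set.mem_inter_iff, Set.mem_preimage, Set.mem_singleton_iff,
          Set.mem_empty_iff_false, iff_false]
        rintro ⟨rfl, h2, -⟩
        exact hwD h2
      rw [Set.indicator_of_notMem hwD, zero_mul, e, measure_empty]
  rw [Finset.sum_congr rfl fun w _ => term w, sum_measure_preimage_singleton _ fun w _ => hw w,
    Measure.restrict_apply (hg (Finset.measurableSet _))]
  refine measure_congr ?_
  filter_upwards [show ∀ᵐ z ∂q, z ∈ (S : Set E) from hS] with z hz
  refine propext ⟨fun h => h.2, fun h => ⟨?_, h⟩⟩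
  exact Finset.mem_coe.2 (Finset.mem_image_of_mem g hz)

variable {Ω : Type*} [MeasurableSpace Ω] {μ : Measure Ω} [IsProbabilityMeasure μ]
  {Z : Ω → E} {Y : Ω → F}

/-- The conditional law of `f Z` given `(g Z, Y)`, from a discrete conditional law of `Z` given `Y`.
As `F` carries an arbitrary `σ`-algebra, the discreteness can only be assumed almost surely on `Ω`,
not almost everywhere for the law of `Y`. -/
theorem condDistrib_ae_eq_fiberKernel [MeasurableSingletonClass E] [StandardBorelSpace V]
    [Nonempty V] (hZ : Measurable Z) (hY : Measurable Y) (q : Kernel F E) [IsMarkovKernel q]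
    (hq : μ.map (fun ω => (Y ω, Z ω)) = μ.map Y ⊗ₘ q)
    (hfin : ∀ᵐ ω ∂μ, ∃ S : Finset E, q (Y ω) (S : Set E)ᶜ = 0) {g : E → W} (hg : Measurable g)
    {f : E → V} (hf : Measurable f) :
    ∀ᵐ ω ∂μ, condDistrib (fun ω => f (Z ω)) (fun ω => (g (Z ω), Y ω)) μ (g (Z ω), Y ω) =
      fiberKernel q hg hf (g (Z ω), Y ω) := by
  have hgY : Measurable fun ω => (g (Z ω), Y ω) := (hg.comp hZ).prodMk hY
  have hfZ : Measurable fun ω => f (Z ω) := hf.comp hZ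
  have : IsProbabilityMeasure (μ.map Y) := Measure.isProbabilityMeasure_map hY.aemeasurable
  have : IsProbabilityMeasure (μ.map fun ω => (g (Z ω), Y ω)) :=
    Measure.isProbabilityMeasure_map hgY.aemeasurable
  have : IsProbabilityMeasure (μ.map fun ω => ((g (Z ω), Y ω), f (Z ω))) :=
    Measure.isProbabilityMeasure_map (hgY.prodMk hfZ).aemeasurable
  refine ae_of_ae_map hgY.aemeasurable
    (condDistrib_ae_eq_of_measure_eq_compProd_of_measurable hgY hfZ ?_)
  refine Measure.ext_prod fun {s t} hs ht => ?_
  have hswap : Measurable fun p : F × E => (g p.2, p.1) :=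
    (hg.comp measurable_snd).prodMk measurable_fst
  have hη : Measurable (s.indicator fun p => fiberKernel q hg hf p t) :=
    (Kernel.measurable_coe _ ht).indicator hs
  have hη' : Measurable fun p : F × E =>
      s.indicator (fun p => fiberKernel q hg hf p t) (g p.2, p.1) := hη.comp hswap
  have hset : MeasurableSet {p : F × E | (g p.2, p.1) ∈ s ∧ f p.2 ∈ t} :=
    (hswap hs).inter ((hf.comp measurable_snd) ht)
  calc μ.map (fun ω => ((g (Z ω), Y ω), f (Z ω))) (s ×ˢ t)
      = μ.map (fun ω => (Y ω, Z ω)) {p : F × E | (g p.2, p.1) ∈ s ∧ f p.2 ∈ t} := by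
        rw [Measure.map_apply (hgY.prodMk hfZ) (hs.prod ht), Measure.map_apply (hY.prodMk hZ) hset]
        rfl
    _ = ∫⁻ ω, q (Y ω) {z | (g z, Y ω) ∈ s ∧ f z ∈ t} ∂μ := by
        rw [hq, Measure.compProd_apply hset,
          lintegral_map (Kernel.measurable_kernel_prodMk_left hset) hY]
        rfl
    _ = ∫⁻ ω, ∫⁻ z, s.indicator (fun p => fiberKernel q hg hf p t) (g z, Y ω) ∂q (Y ω) ∂μ := by
        refine lintegral_congr_ae ?_
        filter_upwards [hfin] with ω ⟨S, hS⟩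
        refine (lintegral_inv_mul_measure_fiber (q (Y ω)) hS hg {w | (w, Y ω) ∈ s}
          (f ⁻¹' t)).symm.trans ?_
        refine lintegral_congr fun z => ?_
        by_cases hz : (g z, Y ω) ∈ s
        · rw [Set.indicator_of_mem hz, Set.indicator_of_mem (by exact hz), fiberKernel_apply,
            Measure.map_apply hf ht, cond_apply (hg (measurableSet_singleton _))]
        · rw [Set.indicator_of_notMem hz, Set.indicator_of_notMem (by exact hz)]
    _ = ∫⁻ p, s.indicator (fun p => fiberKernel q hg hf p t) (g p.2, p.1)
          ∂μ.map (fun ω => (Y ω, Z ω)) := by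
        rw [hq, Measure.lintegral_compProd hη']
        exact (lintegral_map hη'.lintegral_kernel_prod_right' hY).symm
    _ = (μ.map (fun ω => (g (Z ω), Y ω)) ⊗ₘ fiberKernel q hg hf) (s ×ˢ t) := by
        rw [Measure.compProd_apply_prod hs ht, ← lintegral_indicator hs,
          lintegral_map hη hgY, lintegral_map hη' (hY.prodMk hZ)]

/-- A variable with a discrete conditional law almost surely takes one of its atoms as value. -/
theorem ae_kernel_singleton_ne_zero [MeasurableEq E] (hZ : Measurable Z) (hY : Measurable Y)
    (q : Kernel F E) [IsMarkovKernel q] (hq : μ.map (fun ω => (Y ω, Z ω)) = μ.map Y ⊗ₘ q)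
    (hfin : ∀ᵐ ω ∂μ, ∃ S : Finset E, q (Y ω) (S : Set E)ᶜ = 0) :
    ∀ᵐ ω ∂μ, q (Y ω) {Z ω} ≠ 0 := by
  have : IsProbabilityMeasure (μ.map Y) := Measure.isProbabilityMeasure_map hY.aemeasurable
  have hm : MeasurableSet {r : (F × E) × E | r.2 = r.1.2} :=
    measurableSet_eq_fun measurable_snd (measurable_snd.comp measurable_fst)
  have hN : MeasurableSet {p : F × E | q p.1 {p.2} = 0} :=
    (Kernel.measurable_kernel_prodMk_left (κ := q.comap Prod.fst measurable_fst) hm)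
      (measurableSet_singleton 0)
  have key : μ.map (fun ω => (Y ω, Z ω)) {p : F × E | q p.1 {p.2} = 0} = 0 := by
    rw [hq, Measure.compProd_apply hN,
      lintegral_map (Kernel.measurable_kernel_prodMk_left hN) hY]
    refine lintegral_eq_zero_of_ae_eq_zero ?_
    filter_upwards [hfin] with ω ⟨S, hS⟩
    have h1 : q (Y ω) (⋃ z ∈ {z ∈ (S : Set E) | q (Y ω) {z} = 0}, {z}) = 0 :=
      (measure_biUnion_null_iff (S.countable_toSet.mono fun z hz => hz.1)).2 fun z hz => hz.2
    refine measure_mono_null (fun z hz => ?_) (measure_union_null h1 hS)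
    by_cases hzS : z ∈ (S : Set E)
    · exact Or.inl (Set.mem_biUnion (show z ∈ {z ∈ (S : Set E) | q (Y ω) {z} = 0} from ⟨hzS, hz⟩)
        rfl)
    · exact Or.inr hzS
  rw [Measure.map_apply (hY.prodMk hZ) hN] at key
  exact (ae_iff.2 (by simpa using key))

end Fiber

/-! ### Uniform measures on finite sets -/

section Uniform

variable {E : Type*} [MeasurableSpace E] [MeasurableSingletonClass E]

theorem uniformOn_apply_of_finite {S : Set E} (hS : S.Finite) (A : Set E) :
    uniformOn S A = ((A ∩ S).ncard : ℝ≥0∞) / (S.ncard : ℝ≥0∞) := by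
  have e : ∀ T : Set E, T.Finite → Measure.count T = (T.ncard : ℝ≥0∞) := fun T hT => by
    rw [Measure.count_apply_finite T hT, Set.ncard_eq_toFinset_card T hT]
  rw [uniformOn, cond_apply hS.measurableSet, e S hS, e _ (hS.subset Set.inter_subset_left),
    Set.inter_comm S A, mul_comm, div_eq_mul_inv]

theorem pi_uniformOn {ι : Type*} [Fintype ι] {S : ι → Set E} (hS : ∀ j, (S j).Finite)
    (hne : ∀ j, (S j).Nonempty) :
    (Measure.pi fun j => uniformOn (S j)) = uniformOn (Set.univ.pi S) := by
  have : ∀ j, IsProbabilityMeasure (uniformOn (S j)) := fun j =>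
    isProbabilityMeasure_uniformOn (hS j) (hne j)
  refine Measure.pi_eq fun t ht => ?_
  have nc : ∀ T : ι → Set E, (Set.univ.pi T).ncard = ∏ j, (T j).ncard := fun T => by
    simp_rw [← Nat.card_coe_set_eq]
    rw [← Nat.card_pi]
    exact Nat.card_congr (Equiv.Set.univPi T)
  rw [uniformOn_apply_of_finite (Set.Finite.pi hS), ← Set.pi_inter_distrib, nc, nc]
  simp_rw [uniformOn_apply_of_finite (hS _)]
  push_cast
  rw [ENNReal.prod_div_distrib]
  exact fun j _ k _ _ => Or.inr (ENNReal.natCast_ne_top _)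

theorem map_uniformOn_of_injective {E' : Type*} [MeasurableSpace E'] [MeasurableSingletonClass E']
    {S : Set E} (hS : S.Finite) {f : E → E'} (hf : Measurable f) (hinj : Function.Injective f) :
    (uniformOn S).map f = uniformOn (f '' S) := by
  ext A hA
  rw [Measure.map_apply hf hA, uniformOn_apply_of_finite hS,
    uniformOn_apply_of_finite (hS.image f), Set.ncard_image_of_injective _ hinj,
    ← Set.ncard_image_of_injective (f ⁻¹' A ∩ S) hinj, Set.inter_comm, Set.image_inter_preimage,
    Set.inter_comm]

theorem measure_eq_one_of_singleton {ν : Measure E} {C : Set E} (hC : C.Finite)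
    (hne : C.Nonempty) (h : ∀ v ∈ C, ν {v} = (C.ncard : ℝ≥0∞)⁻¹) : ν C = 1 := by
  have hc : (C.ncard : ℝ≥0∞) ≠ 0 := by
    rw [Nat.cast_ne_zero, Ne, Set.ncard_eq_zero hC]
    exact hne.ne_empty
  have : ν C = ∑ v ∈ hC.toFinset, ν {v} := by rw [sum_measure_singleton, hC.coe_toFinset]
  rw [this, Finset.sum_congr rfl fun v hv => h v (hC.mem_toFinset.1 hv), Finset.sum_const,
    ← Set.ncard_eq_toFinset_card C hC, nsmul_eq_mul, ENNReal.mul_inv_cancel hc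
      (ENNReal.natCast_ne_top _)]

/-- If the conditional law of `V` given `W` is almost surely uniform on a finite random set `C`
containing `V`, then the conditional entropy is the mean of `log |C|`. No measurability of `C` is
assumed: `|C|` is read off from the conditional probability of the value of `V`. -/
theorem condEntropy_of_condDistrib_uniform {Ω F : Type*} [MeasurableSpace Ω] [MeasurableSpace F]
    [StandardBorelSpace E] [Nonempty E] {μ : Measure Ω} [IsProbabilityMeasure μ] {V : Ω → E}
    {W : Ω → F} (hV : Measurable V) (hW : Measurable W) {C : Ω → Set E}
    (hfin : ∀ᵐ ω ∂μ, (C ω).Finite) (hmem : ∀ᵐ ω ∂μ, V ω ∈ C ω)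
    (hin : ∀ᵐ ω ∂μ, ∀ v ∈ C ω, condDistrib V W μ (W ω) {v} = ((C ω).ncard : ℝ≥0∞)⁻¹)
    (hout : ∀ᵐ ω ∂μ, ∀ v ∉ C ω, condDistrib V W μ (W ω) {v} = 0) :
    CondDiscrete V W μ ∧ AEMeasurable (fun ω => Real.log ((C ω).ncard : ℝ)) μ ∧
      condEntropy V W μ = ∫⁻ ω, ENNReal.ofReal (Real.log ((C ω).ncard : ℝ)) ∂μ := by
  have hm : MeasurableSet {r : (Ω × E) × E | r.2 = r.1.2} :=
    measurableSet_eq_fun measurable_snd (measurable_snd.comp measurable_fst)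
  have hatom : Measurable fun p : Ω × E => condDistrib V W μ (W p.1) {p.2} :=
    Kernel.measurable_kernel_prodMk_left
      (κ := (condDistrib V W μ).comap (fun p : Ω × E => W p.1) (hW.comp measurable_fst)) hm
  have hpos : ∀ᵐ ω ∂μ, (C ω).ncard ≠ 0 := by
    filter_upwards [hfin, hmem] with ω h1 h2
    exact ((Set.ncard_pos h1).2 ⟨_, h2⟩).ne'
  refine ⟨⟨fun ω => {v | condDistrib V W μ (W ω) {v} ≠ 0}, ?_, ?_, ?_⟩, ?_, ?_⟩
  · exact (hatom (measurableSet_singleton 0)).compl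
  · filter_upwards [hfin, hout] with ω h1 h2
    refine h1.countable.mono fun v hv => ?_
    by_contra hvC
    exact hv (h2 v hvC)
  · filter_upwards [hfin, hmem, hin, hout] with ω h1 h2 h3 h4
    have e : {v | condDistrib V W μ (W ω) {v} ≠ 0} = C ω := by
      ext v
      by_cases hv : v ∈ C ω
      · simp [hv, h3 v hv]
      · simp [hv, h4 v hv]
    rw [e]
    exact measure_eq_one_of_singleton h1 ⟨_, h2⟩ h3
  · refine ⟨fun ω => Real.log (condDistrib V W μ (W ω) {V ω})⁻¹.toReal, ?_, ?_⟩
    · exact Real.measurable_log.comp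
        (hatom.comp (measurable_id.prodMk hV)).inv.ennreal_toReal
    · filter_upwards [hmem, hin] with ω h2 h3
      rw [h3 _ h2, inv_inv, ENNReal.toReal_natCast]
  · refine lintegral_congr_ae ?_
    filter_upwards [hfin, hin, hout, hpos] with ω h1 h3 h4 h5
    rw [tsum_eq_sum (s := h1.toFinset) fun v hv => by
      rw [h4 v (by simpa using hv)]; simp]
    have e : ∀ v ∈ h1.toFinset, ENNReal.ofReal (Real.negMulLog
        (condDistrib V W μ (W ω) {v}).toReal) =
        ENNReal.ofReal (((C ω).ncard : ℝ)⁻¹ * Real.log ((C ω).ncard : ℝ)) := fun v hv => by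
      rw [h3 v (by simpa using hv), ENNReal.toReal_inv, ENNReal.toReal_natCast, Real.negMulLog,
        Real.log_inv]
      ring_nf
    rw [Finset.sum_congr rfl e, Finset.sum_const, ← Set.ncard_eq_toFinset_card _ h1, nsmul_eq_mul,
      ← ENNReal.ofReal_natCast, ← ENNReal.ofReal_mul (by positivity), ← mul_assoc,
      mul_inv_cancel₀ (by exact_mod_cast h5), one_mul]

end Uniform

/-! ### The conditional law of an output -/

section Output

variable {G : Type*} [Group G]

theorem FinCoset.finite (C : FinCoset G) : C.carrier.Finite := by
  obtain ⟨g, H, -, fH, hC⟩ := C.isCoset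
  rw [hC]
  exact fH.smul_set

theorem FinCoset.nonempty (C : FinCoset G) : C.carrier.Nonempty := by
  obtain ⟨g, H, -, -, hC⟩ := C.isCoset
  rw [hC]
  exact ⟨g • 1, Set.smul_mem_smul_set H.one_mem⟩

theorem FinCoset.exists_eq_smul (C : FinCoset G) {x : G} (hx : x ∈ C.carrier) :
    ∃ H : Subgroup G, H.Normal ∧ (H : Set G).Finite ∧ C.carrier = x • (H : Set G) := by
  obtain ⟨g, H, hH, fH, hC⟩ := C.isCoset
  refine ⟨H, hH, fH, ?_⟩
  rw [hC, Set.mem_smul_set_iff_inv_smul_mem] at hx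
  rw [hC]
  exact (leftCoset_eq_iff H).2 hx

/-- An output with index less than `L * 2 ^ n` depends on the first `L * 2 ^ n` inputs only. -/
theorem polarMap_congr {n L i : ℕ} (hi : i < L * 2 ^ n) {x x' : ℕ → G}
    (h : ∀ j < L * 2 ^ n, x j = x' j) : polarMap n i x = polarMap n i x' := by
  have hm : i / 2 ^ n < L := Nat.div_lt_of_lt_mul (by rwa [mul_comm])
  rw [← Nat.div_add_mod' i (2 ^ n)]
  refine polarMap_block_congr (fun s hs => h _ ?_) (Nat.mod_lt _ (by positivity))
  calc i / 2 ^ n * 2 ^ n + s < (i / 2 ^ n + 1) * 2 ^ n := by rw [add_mul]; omega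
    _ ≤ L * 2 ^ n := Nat.mul_le_mul_right _ hm

/-- A finite sequence continued by ones. -/
def extendOne (M : ℕ) (z : Fin M → G) : ℕ → G :=
  fun j => if h : j < M then z ⟨j, h⟩ else 1

theorem extendOne_of_lt {M j : ℕ} (h : j < M) (z : Fin M → G) : extendOne M z j = z ⟨j, h⟩ :=
  dif_pos h

theorem extendOne_of_le {M j : ℕ} (h : M ≤ j) (z : Fin M → G) : extendOne M z j = 1 :=
  dif_neg h.not_gt

theorem extendOne_injective (M : ℕ) : Function.Injective (extendOne M : (Fin M → G) → ℕ → G) := by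
  intro z z' h
  funext j
  have := congrFun h j
  rwa [extendOne_of_lt j.2, extendOne_of_lt j.2] at this

theorem image_extendOne_pi (H : ℕ → Subgroup G) (M : ℕ) (x : Fin M → G) :
    extendOne M '' (Set.univ.pi fun j : Fin M => x j • (H j : Set G)) =
      cosetBox H M (extendOne M x) := by
  ext y
  constructor
  · rintro ⟨z, hz, rfl⟩
    refine ⟨fun j => ?_, fun j hj => by rw [extendOne_of_le hj, extendOne_of_le hj]⟩
    rcases lt_or_ge j M with hj | hj
    · rw [extendOne_of_lt hj, extendOne_of_lt hj]
      exact Set.mem_smul_set_iff_inv_smul_mem.1 (hz ⟨j, hj⟩ trivial)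
    · simp [extendOne_of_le hj, (H j).one_mem]
  · rintro ⟨h1, h2⟩
    refine ⟨fun j => y j, fun j _ => ?_, ?_⟩
    · have := h1 j
      rw [extendOne_of_lt j.2] at this
      exact Set.mem_smul_set_iff_inv_smul_mem.2 this
    · funext j
      rcases lt_or_ge j M with hj | hj
      · rw [extendOne_of_lt hj]
      · rw [h2 j hj, extendOne_of_le hj, extendOne_of_le hj]

variable [MeasurableSpace G]

theorem measurable_polarMap [MeasurableMul₂ G] (n i : ℕ) :
    Measurable (polarMap n i : (ℕ → G) → G) := by
  induction n generalizing i with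
  | zero => exact measurable_pi_apply i
  | succ n ih =>
    have h1 := ih (leftIdx n (i / 2))
    have h2 := ih (leftIdx n (i / 2) + 2 ^ n)
    rcases Nat.mod_two_eq_zero_or_one i with hi | hi
    · have e : (polarMap (n + 1) i : (ℕ → G) → G) = fun x =>
          polarMap n (leftIdx n (i / 2)) x * polarMap n (leftIdx n (i / 2) + 2 ^ n) x := by
        funext x
        simp [polarMap, polarU, hi]
      rw [e]
      exact h1.mul h2
    · have e : (polarMap (n + 1) i : (ℕ → G) → G) =
          polarMap n (leftIdx n (i / 2) + 2 ^ n) := by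
        funext x
        simp [polarMap, polarU, hi]
      rw [e]
      exact h2

/-- The next output is uniform on its coset when the inputs are uniform on the fibre over the
previous outputs: the fibres over the longer prefixes are all of the same size. -/
theorem map_uniformOn_prefixFiber [MeasurableSingletonClass G] [MeasurableMul₂ G]
    {H : ℕ → Subgroup G} (hH : ∀ j, (H j).Normal)
    (fH : ∀ j, (H j : Set G).Finite) {n L i : ℕ} (hi : i < L * 2 ^ n) (x : ℕ → G) (v : G) :
    (v ∈ polarMap n i x • (polarSubgroup H n i : Set G) →
      (uniformOn (prefixFiber n H (L * 2 ^ n) i x)).map (polarMap n i) {v} =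
        ((polarMap n i x • (polarSubgroup H n i : Set G)).ncard : ℝ≥0∞)⁻¹) ∧
    (v ∉ polarMap n i x • (polarSubgroup H n i : Set G) →
      (uniformOn (prefixFiber n H (L * 2 ^ n) i x)).map (polarMap n i) {v} = 0) := by
  have hfin := prefixFiber_finite fH n (L * 2 ^ n) i x
  rw [Measure.map_apply (measurable_polarMap n i) (measurableSet_singleton v),
    uniformOn_apply_of_finite hfin]
  have e : polarMap n i ⁻¹' {v} ∩ prefixFiber n H (L * 2 ^ n) i x =
      {x' ∈ prefixFiber n H (L * 2 ^ n) i x | polarMap n i x' = v} := by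
    ext z
    exact and_comm
  rw [e, Set.mem_smul_set_iff_inv_smul_mem]
  refine ⟨fun hv => ?_, fun hv => ?_⟩
  · obtain ⟨y, hy⟩ := exists_prefixFiber_succ_eq hH hi hv
    have hpos : ∀ k, (polarSubgroup H n k : Set G).ncard ≠ 0 := fun k =>
      ((Set.ncard_pos (polarSubgroup_finite hH fH n k)).2 ⟨1, one_mem _⟩).ne'
    have hc : ∏ k ∈ Finset.Ico (i + 1) (L * 2 ^ n), (polarSubgroup H n k : Set G).ncard ≠ 0 :=
      Finset.prod_ne_zero_iff.2 fun k _ => hpos k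
    rw [hy, ncard_prefixFiber hH fH hi, ncard_prefixFiber hH fH hi.le,
      Finset.prod_eq_prod_Ico_succ_bot hi, Set.ncard_smul_set, Nat.cast_mul]
    generalize ∏ k ∈ Finset.Ico (i + 1) (L * 2 ^ n), (polarSubgroup H n k : Set G).ncard = c at hc ⊢
    nth_rewrite 1 [← one_mul (c : ℝ≥0∞)]
    rw [ENNReal.mul_div_mul_right _ _ (by exact_mod_cast hc) (ENNReal.natCast_ne_top _), one_div]
  · have : {x' ∈ prefixFiber n H (L * 2 ^ n) i x | polarMap n i x' = v} = ∅ := by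
      ext z
      simp only [Set.mem_sep_iff, Set.mem_empty_iff_false, iff_false, not_and]
      rintro hz rfl
      exact hv (inv_polarMap_mul_mem_of_mem_prefixFiber hH hz)
    rw [this]
    simp

/-- Almost surely, all the values of the conditional law in an erasure distribution are given by
the uniform law: a countable generating algebra of Borel sets suffices. -/
theorem IsErasure.ae_condDistrib_eq_uniformOn {Ω : Type*} [MeasurableSpace Ω]
    [StandardBorelSpace G] [MeasurableSpace (FinCoset G)] {X : Ω → G} {Y : Ω → FinCoset G}
    {μ : Measure Ω} [IsProbabilityMeasure μ] (h : IsErasure X Y μ) :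
    ∀ᵐ ω ∂μ, condDistrib X Y μ (Y ω) = uniformOn (Y ω).carrier := by
  set 𝒜 := generateSetAlgebra (MeasurableSpace.countableGeneratingSet G) with h𝒜
  have hgen : MeasurableSpace.generateFrom 𝒜 = ‹MeasurableSpace G› := by
    rw [h𝒜, generateFrom_generateSetAlgebra_eq,
      MeasurableSpace.generateFrom_countableGeneratingSet]
  have hcount : 𝒜.Countable :=
    countable_generateSetAlgebra MeasurableSpace.countable_countableGeneratingSet
  have hmeas : ∀ B ∈ 𝒜, MeasurableSet B := fun B hB => by
    rw [← hgen]
    exact MeasurableSpace.measurableSet_generateFrom hB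
  have hpi : IsPiSystem 𝒜 := isSetAlgebra_generateSetAlgebra.isSetRing.isSetSemiring.isPiSystem
  filter_upwards [(ae_ball_iff hcount).2 fun B hB => h B (hmeas B hB)] with ω hω
  have := isProbabilityMeasure_uniformOn (Y ω).finite (Y ω).nonempty
  refine ext_of_generate_finite 𝒜 hgen.symm hpi (fun B hB => ?_) (by simp)
  rw [hω B hB, uniformOn_apply_of_finite (Y ω).finite, FinCoset.card]

theorem measurable_extendOne (M : ℕ) : Measurable (extendOne M : (Fin M → G) → ℕ → G) := by
  refine measurable_pi_lambda _ fun j => ?_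
  rcases lt_or_ge j M with hj | hj
  · simpa only [extendOne_of_lt hj] using measurable_pi_apply _
  · simpa only [extendOne_of_le hj] using measurable_const

end Output

/-! ### The entropies of the outputs -/

theorem corollary1 {Ω : Type*} {G : Type*} [MeasurableSpace Ω] (μ : Measure Ω)
    [IsProbabilityMeasure μ] [Group G] [TopologicalSpace G] [IsTopologicalGroup G] [PolishSpace G]
    [MeasurableSpace G] [BorelSpace G] [MeasurableSpace (FinCoset G)]
    (X : ℕ → Ω → G) (Y : ℕ → Ω → FinCoset G)
    (hX : ∀ i, Measurable (X i)) (hY : ∀ i, Measurable (Y i))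
    (hindep : iIndepFun (fun i ω => (X i ω, Y i ω)) μ)
    (herase : ∀ i, IsErasure (X i) (Y i) μ) (n i : ℕ) :
    CondDiscrete (polarU X n i) (past X Y n i) μ ∧
    AEMeasurable (fun ω => Real.log ((polarY X Y n i ω).card : ℝ)) μ ∧
    condEntropy (polarU X n i) (past X Y n i) μ =
      ∫⁻ ω, ENNReal.ofReal (Real.log ((polarY X Y n i ω).card : ℝ)) ∂μ := by
  -- All the inputs up to the end of the block of `i`.
  set L := i / 2 ^ n + 1 with hL
  have hi : i < L * 2 ^ n := by
    rw [mul_comm]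
    exact Nat.lt_mul_div_succ i (by positivity)
  set M := L * 2 ^ n with hM
  let Z : Ω → ℕ → G := fun ω => extendOne M fun j : Fin M => X j ω
  let g : (ℕ → G) → Fin i → G := fun x k => polarMap n k x
  have hYm : Measurable fun ω j => Y j ω := measurable_pi_lambda _ hY
  have hXm : Measurable fun ω (j : Fin M) => X j ω := measurable_pi_lambda _ fun j => hX j
  have hZ : Measurable Z := (measurable_extendOne M).comp hXm
  have hg : Measurable g := measurable_pi_lambda _ fun k => measurable_polarMap n k
  have hUZ : ∀ k < M, polarU X n k = fun ω => polarMap n k (Z ω) := fun k hk => by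
    funext ω
    rw [polarU_eq_polarMap]
    exact polarMap_congr hk fun j hj => (extendOne_of_lt hj fun j : Fin M => X j ω).symm
  have hpast : past X Y n i = fun ω => (g (Z ω), fun j => Y j ω) := by
    funext ω
    refine Prod.ext (funext fun k => ?_) rfl
    exact congrFun (hUZ k (k.2.trans hi)) ω
  -- The conditional law of `Z` given `Y`.
  have hκ : ∀ j, μ.map (fun ω => (Y j ω, X j ω)) = μ.map (Y j) ⊗ₘ condDistrib (X j) (Y j) μ :=
    fun j => (compProd_map_condDistrib (hX j).aemeasurable).symm
  let q₀ : Kernel (ℕ → FinCoset G) (Fin M → G) := kernelPi fun j : Fin M =>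
    (condDistrib (X j) (Y j) μ).comap (fun y : ℕ → FinCoset G => y j) (measurable_pi_apply _)
  let q : Kernel (ℕ → FinCoset G) (ℕ → G) := q₀.map (extendOne M)
  have : IsMarkovKernel q := Kernel.IsMarkovKernel.map _ (measurable_extendOne M)
  have hq : μ.map (fun ω => ((fun j => Y j ω), Z ω)) = μ.map (fun ω j => Y j ω) ⊗ₘ q := by
    rw [Measure.compProd_map (measurable_extendOne M),
      ← map_prodMk_eq_compProd_kernelPi hX hY hindep _ hκ M,
      Measure.map_map (measurable_id.prodMap (measurable_extendOne M)) (hYm.prodMk hXm)]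
    rfl
  have herase' : ∀ᵐ ω ∂μ, ∀ j, condDistrib (X j) (Y j) μ (Y j ω) = uniformOn (Y j ω).carrier :=
    ae_all_iff.2 fun j => (herase j).ae_condDistrib_eq_uniformOn
  have hmem : ∀ᵐ ω ∂μ, ∀ j, X j ω ∈ (Y j ω).carrier := by
    refine ae_all_iff.2 fun j => ?_
    have hfin : ∀ᵐ ω ∂μ, ∃ S : Finset G, condDistrib (X j) (Y j) μ (Y j ω) (S : Set G)ᶜ = 0 := by
      filter_upwards [herase'] with ω hω
      refine ⟨(Y j ω).finite.toFinset, ?_⟩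
      rw [hω j, (Y j ω).finite.coe_toFinset, uniformOn_eq_zero_iff (Y j ω).finite,
        Set.inter_compl_self]
    filter_upwards [herase', ae_kernel_singleton_ne_zero (hX j) (hY j) _ (hκ j) hfin]
      with ω h1 h2
    rw [h1 j, Ne, uniformOn_eq_zero_iff (Y j ω).finite] at h2
    obtain ⟨x, hx, rfl⟩ := Set.nonempty_iff_ne_empty.2 h2
    exact hx
  -- The subgroups may be chosen after `ω` is fixed, without any measurability.
  have hgood : ∀ᵐ ω ∂μ, ∃ H : ℕ → Subgroup G, (∀ j, (H j).Normal) ∧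
      (∀ j, (H j : Set G).Finite) ∧ (∀ j, (Y j ω).carrier = X j ω • (H j : Set G)) ∧
      q (fun j => Y j ω) = uniformOn (cosetBox H M (Z ω)) := by
    filter_upwards [herase', hmem] with ω h1 h2
    choose H hH fH hYH using fun j => (Y j ω).exists_eq_smul (h2 j)
    refine ⟨H, hH, fH, hYH, ?_⟩
    have e : q₀ (fun j => Y j ω) = Measure.pi fun j : Fin M => uniformOn (X j ω • (H j : Set G)) := by
      rw [kernelPi_apply]
      congr 1
      funext j
      rw [Kernel.comap_apply, h1, hYH]
    have fin : ∀ j : Fin M, (X j ω • (H j : Set G)).Finite := fun j => (fH j).smul_set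
    rw [Kernel.map_apply _ (measurable_extendOne M), e,
      pi_uniformOn fin fun j => ⟨X j ω • 1, Set.smul_mem_smul_set (one_mem _)⟩,
      map_uniformOn_of_injective (Set.Finite.pi fin) (measurable_extendOne M)
        (extendOne_injective M), image_extendOne_pi]
  have hfin : ∀ᵐ ω ∂μ, ∃ S : Finset (ℕ → G), q (fun j => Y j ω) (S : Set (ℕ → G))ᶜ = 0 := by
    filter_upwards [hgood] with ω ⟨H, hH, fH, hYH, hqω⟩
    have hbox := cosetBox_finite fH M (Z ω)
    refine ⟨hbox.toFinset, ?_⟩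
    rw [hqω, hbox.coe_toFinset, uniformOn_eq_zero_iff hbox, Set.inter_compl_self]
  have hlaw : ∀ᵐ ω ∂μ, ∃ H : ℕ → Subgroup G, (∀ j, (H j).Normal) ∧ (∀ j, (H j : Set G).Finite) ∧
      (polarY X Y n i ω).carrier = polarMap n i (Z ω) • (polarSubgroup H n i : Set G) ∧
      condDistrib (polarU X n i) (past X Y n i) μ (past X Y n i ω) =
        (uniformOn (prefixFiber n H M i (Z ω))).map (polarMap n i) := by
    rw [hpast, hUZ i hi]
    filter_upwards [hgood, condDistrib_ae_eq_fiberKernel hZ hYm q hq hfin hg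
      (measurable_polarMap n i)] with ω ⟨H, hH, fH, hYH, hqω⟩ hω
    refine ⟨H, hH, fH, ?_, ?_⟩
    · rw [polarY_carrier hH hYH, hUZ i hi]
    · have hbox := cosetBox_finite fH M (Z ω)
      have hgm : MeasurableSet (g ⁻¹' {g (Z ω)}) := hg (measurableSet_singleton _)
      have e : cosetBox H M (Z ω) ∩ g ⁻¹' {g (Z ω)} = prefixFiber n H M i (Z ω) := by
        ext x
        simp only [prefixFiber, Set.mem_inter_iff, Set.mem_preimage, Set.mem_singleton_iff,
          Set.mem_ofPred_eq, and_congr_right_iff, g, funext_iff]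
        exact fun _ => ⟨fun h k hk => h ⟨k, hk⟩, fun h k => h k k.2⟩
      have e' : (uniformOn (cosetBox H M (Z ω)))[|g ⁻¹' {g (Z ω)}] =
          uniformOn (prefixFiber n H M i (Z ω)) := by
        rw [← e]
        exact cond_cond_eq_cond_inter' hbox.measurableSet hgm
          (by rw [Measure.count_apply_finite _ hbox]; exact ENNReal.natCast_ne_top _)
      rw [hω, fiberKernel_apply, hqω, e']
  have hpastm : Measurable (past X Y n i) := by
    rw [hpast]
    exact (hg.comp hZ).prodMk hYm
  have hUm : Measurable (polarU X n i) := by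
    rw [hUZ i hi]
    exact (measurable_polarMap n i).comp hZ
  refine condEntropy_of_condDistrib_uniform (C := fun ω => (polarY X Y n i ω).carrier) hUm hpastm
    (Filter.Eventually.of_forall fun ω => (polarY X Y n i ω).finite) ?_ ?_ ?_
  · filter_upwards [hlaw] with ω ⟨H, _, _, hC, _⟩
    rw [hC, hUZ i hi]
    exact ⟨1, one_mem _, by simp⟩
  · filter_upwards [hlaw] with ω ⟨H, hH, fH, hC, hν⟩ v hv
    rw [hC] at hv ⊢
    rw [hν]
    exact (map_uniformOn_prefixFiber hH fH hi (Z ω) v).1 hv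
  · filter_upwards [hlaw] with ω ⟨H, hH, fH, hC, hν⟩ v hv
    rw [hC] at hv
    rw [hν]
    exact (map_uniformOn_prefixFiber hH fH hi (Z ω) v).2 hv
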